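/- For a finite simple connected graph $G$, let $r_G(i,j)=(e_i-e_j)^TL^\dagger(e_i-e_j)$ be the effective resistance ($L^\dagger$ is the Moore–Penrose pseudoinverse of the graph Laplacian), let $\mu(G,v)=\sum_{i\in V(G)}d_i\,r_G(i,v)$ be the moment of $v$ ($d_i$ is the degree of $i$), and let $\mathcal K(G)=\sum_j\pi_j m_{ij}$ be Kemeny's constant of the simple random walk on $G$, where $\pi$ is the stationary distribution, $m_{ij}$ is the expected first time $t\ge 0$ at which the walk started at $i$ is at $j$ (so $m_{jj}=0$), and the sum does not depend on $i$. (On a one-vertex graph the walk stays put, so $\mathcal K=0$.) The 1-sum $G_1\oplus_{v_1,v_2}G_2$ is obtained from disjoint copies of $G_1$, $G_2$ by removing $v_1\in V(G_1)$ and replacing every edge $\{i,v_1\}$ of $G_1$ by $\{i,v_2\}$, $v_2\in V(G_2)$; that is, $v_1$ and $v_2$ are identified. **Theorem.** Let $n\ge 1$, let $G_1,\dots,G_n$ be finite simple connected graphs, with $m_i=|E(G_i)|$ and $\sum_i m_i>0$, and let $$G=G_1\oplus_{v_{1,2}}G_2\oplus_{v_{2,3}}\cdots\oplus_{v_{n-1,n}}G_n,$$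 where $v_{i,i+1}$ denotes a vertex of $G_i$ and a vertex of $G_{i+1}$ that are identified in $G$ (the two vertices $v_{i-1,i}$ and $v_{i,i+1}$ of $G_i$ may coincide). For $i\ne j$ put $q_{i,j}=(j-1,j)$ if $j>i$ and $q_{i,j}=(j,j+1)$ if $j<i$. Then Kemeny's constants of $G$ and of all $G_i$ are well defined and finite, and $$\mathcal K(G)=\frac{\displaystyle\sum_{i=1}^n m_i\Bigl(\mathcal K(G_i)+\sum_{j\ne i}\mu(G_j,v_{q_{i,j}})\Bigr)+2\sum_{\substack{1\le i<j\le n\\ j-i\ge 2}}m_im_j\,r_G(v_{i,i+1},v_{j-1,j})}{\displaystyle\sum_{i=1}^n m_i}.$$ -/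

import Mathlib

universe u

noncomputable section

namespace KemenyChain

open scoped ENNReal NNReal
open MeasureTheory ProbabilityTheory

/-! ### Effective resistance -/

/-- The four Penrose conditions: `X` is the Moore-Penrose pseudoinverse of `A`. -/
structure IsMoorePenrose {V : Type*} [Fintype V] (A X : Matrix V V ℝ) : Prop where
  mul_mul_left : A * X * A = A
  mul_mul_right : X * A * X = X
  symm_left : (A * X).transpose = A * X
  symm_right : (X * A).transpose = X * A

/-- The Moore-Penrose pseudoinverse of a real square matrix: the matrix satisfying the four Penrose
conditions. -/
def pinv {V : Type*} [Fintype V] (A : Matrix V V ℝ) : Matrix V V ℝ :=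
  Classical.epsilon (IsMoorePenrose A)

theorem IsMoorePenrose.unique {V : Type*} [Fintype V] {A X Y : Matrix V V ℝ}
    (hX : IsMoorePenrose A X) (hY : IsMoorePenrose A Y) : X = Y := by
  have h1 : A * X = A * Y := by
    calc A * X = (A * X).transpose := hX.symm_left.symm
      _ = ((A * Y * A) * X).transpose := by rw [hY.mul_mul_left]
      _ = (A * X).transpose * (A * Y).transpose := by
          rw [← Matrix.transpose_mul, Matrix.mul_assoc]
      _ = A * X * A * Y := by rw [hX.symm_left, hY.symm_left, Matrix.mul_assoc, Matrix.mul_assoc,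
          Matrix.mul_assoc]
      _ = A * Y := by rw [hX.mul_mul_left]
  have h2 : X * A = Y * A := by
    calc X * A = (X * A).transpose := hX.symm_right.symm
      _ = (X * (A * Y * A)).transpose := by rw [hY.mul_mul_left]
      _ = (Y * A).transpose * (X * A).transpose := by
          rw [← Matrix.transpose_mul, Matrix.mul_assoc, Matrix.mul_assoc]
      _ = Y * (A * X * A) := by rw [hX.symm_right, hY.symm_right, Matrix.mul_assoc,
          Matrix.mul_assoc]
      _ = Y * A := by rw [hX.mul_mul_left]
  calc X = X * A * X := hX.mul_mul_right.symm
    _ = Y * (A * X) := by rw [h2, Matrix.mul_assoc]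
    _ = Y * A * Y := by rw [h1, Matrix.mul_assoc]
    _ = Y := hY.mul_mul_right

/-- A symmetric real matrix has a Moore-Penrose pseudoinverse, and `pinv` is it. -/
theorem isMoorePenrose_pinv {V : Type*} [Fintype V] {A : Matrix V V ℝ} (hA : A.IsHermitian) :
    IsMoorePenrose A (pinv A) := by
  classical
  apply Classical.epsilon_spec (p := IsMoorePenrose A)
  set U : Matrix V V ℝ := (hA.eigenvectorUnitary : Matrix V V ℝ) with hU
  set D : Matrix V V ℝ := Matrix.diagonal hA.eigenvalues with hD
  set E : Matrix V V ℝ := Matrix.diagonal (fun i => (hA.eigenvalues i)⁻¹) with hE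
  have hUU : star U * U = 1 := Unitary.coe_star_mul_self hA.eigenvectorUnitary
  have hspec : A = U * D * star U := by
    have := hA.spectral_theorem
    simpa [Unitary.conjStarAlgAut_apply, hU, hD, Function.comp_def] using this
  have hmul : ∀ P Q : Matrix V V ℝ, (U * P * star U) * (U * Q * star U) = U * (P * Q) * star U := by
    intro P Q
    calc (U * P * star U) * (U * Q * star U) = U * P * (star U * U) * Q * star U := by
          simp only [Matrix.mul_assoc]
      _ = U * (P * Q) * star U := by rw [hUU, Matrix.mul_one, Matrix.mul_assoc U]
  have hsym : ∀ d : V → ℝ, (U * Matrix.diagonal d * star U).transpose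
      = U * Matrix.diagonal d * star U := by
    intro d
    have hst : star U = U.transpose := by
      rw [Matrix.star_eq_conjTranspose, Matrix.conjTranspose_eq_transpose_of_trivial]
    rw [hst, Matrix.transpose_mul, Matrix.transpose_mul, Matrix.transpose_transpose,
      Matrix.diagonal_transpose, Matrix.mul_assoc]
  have hDE : D * E * D = D := by
    simp only [hD, hE, Matrix.diagonal_mul_diagonal]
    congr 1; funext i; exact mul_inv_mul_cancel _
  have hED : E * D * E = E := by
    simp only [hD, hE, Matrix.diagonal_mul_diagonal]
    congr 1; funext i
    have h := mul_inv_mul_cancel (hA.eigenvalues i)⁻¹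
    rwa [inv_inv] at h
  refine ⟨U * E * star U, ?_, ?_, ?_, ?_⟩
  · rw [hspec, hmul, hmul, hDE]
  · rw [hspec, hmul, hmul, hED]
  · rw [hspec, hmul, hD, hE, Matrix.diagonal_mul_diagonal, hsym]
  · rw [hspec, hmul, hD, hE, Matrix.diagonal_mul_diagonal, hsym]

open Classical in
/-- The effective resistance `r_G(i,j) = (e_i - e_j)ᵀ L† (e_i - e_j)`, with `L` the Laplacian. -/
def resistance {V : Type*} [Fintype V] (G : SimpleGraph V) (i j : V) : ℝ :=
  dotProduct (Pi.single i 1 - Pi.single j 1)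
    (Matrix.mulVec (pinv (G.lapMatrix ℝ)) (Pi.single i 1 - Pi.single j 1))

open Classical in
/-- The moment `μ(G,v) = ∑ i, d_i r_G(i,v)`. -/
def graphMoment {V : Type*} [Fintype V] (G : SimpleGraph V) (v : V) : ℝ :=
  ∑ i, (G.degree i : ℝ) * resistance G i v

/-- The number of edges, as a real number. -/
def numEdges {V : Type*} (G : SimpleGraph V) : ℝ := (G.edgeSet.ncard : ℝ)

/-! ### Random walk, hitting times, Kemeny's constant -/

open Classical in
/-- One step of the simple random walk: a uniformly random neighbour of the current vertex
(at an isolated vertex the walk stays put). -/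
def step {V : Type*} [Fintype V] (G : SimpleGraph V) (v : V) : PMF V :=
  if h : (G.neighborFinset v).Nonempty then PMF.uniformOfFinset (G.neighborFinset v) h
  else PMF.pure v

/-- The transition kernel of the walk at time `n`, given the trajectory up to time `n`. -/
def stepKernel {V : Type*} [Fintype V] [MeasurableSpace V] [DiscreteMeasurableSpace V]
    (G : SimpleGraph V) (n : ℕ) : Kernel (Π _ : Finset.Iic n, V) V :=
  (Kernel.ofFunOfCountable fun v => (step G v).toMeasure).comap
    (fun x => x ⟨n, Finset.mem_Iic.2 le_rfl⟩) (measurable_pi_apply _)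

instance {V : Type*} [Fintype V] [MeasurableSpace V] [DiscreteMeasurableSpace V]
    (G : SimpleGraph V) (n : ℕ) : IsMarkovKernel (stepKernel G n) :=
  ⟨fun _ => inferInstanceAs (IsProbabilityMeasure (PMF.toMeasure _))⟩

/-- The law, on the space of trajectories `ℕ → V`, of the simple random walk started at `u`. -/
def walkLaw {V : Type*} [Fintype V] [MeasurableSpace V] [DiscreteMeasurableSpace V]
    (G : SimpleGraph V) (u : V) : Measure (ℕ → V) :=
  Kernel.trajMeasure (X := fun _ => V) (Measure.dirac u) (stepKernel G)

/-- The first time `n ≥ 0` at which the trajectory `ω` is at `j` (infinite if there is none). -/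
def hittingTime {V : Type*} (j : V) (ω : ℕ → V) : ℝ≥0∞ :=
  ⨅ (n : ℕ) (_ : ω n = j), (n : ℝ≥0∞)

/-- The expected hitting time `m_{ij}` of `j` for the simple random walk started at `i`. -/
def meanHittingTime {V : Type*} [Fintype V] (G : SimpleGraph V) (i j : V) : ℝ≥0∞ :=
  letI : MeasurableSpace V := ⊤
  ∫⁻ ω, hittingTime j ω ∂(walkLaw G i)

/-- `π` is a stationary distribution of the simple random walk on `G`. -/
def IsStationary {V : Type*} [Fintype V] (G : SimpleGraph V) (π : PMF V) : Prop :=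
  π.bind (step G) = π

/-- `K` is Kemeny's constant of `G`: the walk has exactly one stationary distribution `π`, and
`∑ j, π_j m_{ij} = K` for every starting vertex `i`. -/
def IsKemenyConstant {V : Type*} [Fintype V] (G : SimpleGraph V) (K : ℝ≥0) : Prop :=
  ∃ π : PMF V, IsStationary G π ∧ (∀ π' : PMF V, IsStationary G π' → π' = π) ∧
    ∀ i : V, ∑ j, π j * meanHittingTime G i j = (K : ℝ≥0∞)

/-- Kemeny's constant of `G`. -/
def kemeny {V : Type*} [Fintype V] (G : SimpleGraph V) : ℝ≥0 :=
  Classical.epsilon (IsKemenyConstant G)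

/-! ### 1-sums -/

/-- The 1-sum of `G₁` and `G₂` at `v₁`, `v₂`: remove `v₁` from `G₁` and replace every edge `{i, v₁}`
of `G₁` by `{i, v₂}`. -/
def oneSum {V W : Type*} (G₁ : SimpleGraph V) (v₁ : V) (G₂ : SimpleGraph W) (v₂ : W) :
    SimpleGraph ({x : V // x ≠ v₁} ⊕ W) where
  Adj
    | .inl x, .inl y => G₁.Adj x y
    | .inr x, .inr y => G₂.Adj x y
    | .inl x, .inr y => y = v₂ ∧ G₁.Adj x v₁
    | .inr x, .inl y => x = v₂ ∧ G₁.Adj y v₁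
  symm := ⟨by
    rintro (x | x) (y | y) h
    · exact G₁.adj_symm h
    · exact h
    · exact h
    · exact G₂.adj_symm h⟩
  loopless := ⟨by
    rintro (x | x) h
    · exact G₁.loopless.irrefl _ h
    · exact G₂.loopless.irrefl _ h⟩

open Classical in
/-- The vertex of the 1-sum corresponding to a vertex of the first summand. -/
def oneSumLeft {V W : Type*} (v₁ : V) (v₂ : W) (x : V) : {x : V // x ≠ v₁} ⊕ W :=
  if h : x = v₁ then .inr v₂ else .inl ⟨x, h⟩

/-- A block of a chain: a finite simple graph with two (possibly equal) marked vertices. In the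
`k`-th block of a chain, `left` is the vertex `v_{k-1,k}` and `right` is the vertex `v_{k,k+1}`
(`left` of the first and `right` of the last block play no role). -/
structure Block : Type (u + 1) where
  V : Type u
  [fintype : Fintype V]
  graph : SimpleGraph V
  left : V
  right : V

attribute [instance] Block.fintype

/-- A finite graph together with a map from the vertices of each of the blocks `B 0, …, B n` to the
vertices of the graph. -/
structure Glued {n : ℕ} (B : Fin (n + 1) → Block.{u}) : Type (u + 1) where
  V : Type u
  [fintype : Fintype V]
  graph : SimpleGraph V
  emb : (k : Fin (n + 1)) → (B k).V → V

attribute [instance] Glued.fintype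

open Classical in
/-- The chain of 1-sums `B 0 ⊕ B 1 ⊕ ⋯ ⊕ B n`, bracketed to the left, where `right` of each block is
identified with `left` of the next one; `emb` records where the vertices of the blocks go. -/
def chain : {n : ℕ} → (B : Fin (n + 1) → Block.{u}) → Glued B
  | 0, B =>
    { V := (B 0).V
      graph := (B 0).graph
      emb := Fin.cases (fun x => x) (fun k => k.elim0) }
  | n + 1, B =>
    let C := chain (fun k : Fin (n + 1) => B k.castSucc)
    let c : C.V := C.emb (Fin.last n) (B (Fin.last n).castSucc).right
    { V := {x : C.V // x ≠ c} ⊕ (B (Fin.last (n + 1))).V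
      graph := oneSum C.graph c (B (Fin.last (n + 1))).graph (B (Fin.last (n + 1))).left
      emb := Fin.lastCases (fun x => Sum.inr x)
        (fun k x => oneSumLeft c (B (Fin.last (n + 1))).left (C.emb k x)) }

end KemenyChain

end

open KemenyChain

/-! Everything reduces to the identity `4 m K(G) = ∑ x, ∑ y, d_x d_y r(x,y)` for a connected graph
with `m` edges (`four_mul_numEdges_mul_kemeny`), because its right-hand side can be computed
blockwise.

For the identity, a finite solution of the first-step equations is the mean hitting time
(`meanHittingTime_eq`). Such a solution is `½ ∑ k, d_k (r(i,j) + r(k,j) - r(i,k))`: by polarization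
of the resistance it is a difference of values of `L†(d - 2m e_j)`, so its Laplacian is `d - 2m e_j`
(`laplacian_hitFun`). Averaging over `j` with weights `d_j / 2m` cancels all dependence on the start
`i`.

In a 1-sum, resistances within a summand are unchanged, and resistances between the two sides add
through the cut vertex (`resistance_oneSum`). Degrees also add at the identified vertex. Hence the
double sum over a chain splits over pairs of blocks. A diagonal pair gives `4 m_i K(G_i)`. A pair `i
< j` gives two moments and one term `4 m_i m_j r` (`blockResistance_lt`); the latter vanishes for
neighbouring blocks, whose attachment vertices coincide. -/

namespace KemenyChain

open scoped ENNReal NNReal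
open MeasureTheory ProbabilityTheory

/-! ### Mean hitting times from first-step equations. -/

open Classical in
/-- The indicator of the event that the trajectory avoids `j` up to time `n`. -/
noncomputable def avoids {V : Type*} (j : V) (n : ℕ) (ω : ℕ → V) : ℝ≥0∞ :=
  if ∀ k ≤ n, ω k ≠ j then 1 else 0

/-- Tail-sum formula: a time with values in `ℕ ∪ {∞}` is the number of `n` strictly before it. The
sum diverges exactly when `j` is never visited. -/
theorem hittingTime_eq_tsum {V : Type*} (j : V) (ω : ℕ → V) :
    hittingTime j ω = ∑' n, avoids j n ω := by
  classical
  by_cases h : ∃ n, ω n = j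
  · have hav : ∀ n, avoids j n ω = if n < Nat.find h then 1 else 0 := by
      intro n
      unfold avoids
      congr 1
      rw [Nat.lt_find_iff]
    have h1 : hittingTime j ω = (Nat.find h : ℝ≥0∞) := by
      unfold hittingTime
      apply le_antisymm
      · exact iInf₂_le (f := fun (n : ℕ) (_ : ω n = j) => (n : ℝ≥0∞)) _ (Nat.find_spec h)
      · refine le_iInf₂ fun n hn => ?_
        exact_mod_cast Nat.find_min' h hn
    rw [h1, tsum_eq_sum (s := Finset.range (Nat.find h))]
    · rw [Finset.sum_congr rfl (g := fun _ => (1 : ℝ≥0∞))]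
      · simp
      · intro n hn
        rw [hav, if_pos (Finset.mem_range.1 hn)]
    · intro n hn
      rw [hav, if_neg (by simpa using hn)]
  · push Not at h
    have h1 : hittingTime j ω = ⊤ := by
      simp [hittingTime, h]
    have h2 : ∀ n, avoids j n ω = 1 := fun n => by simp [avoids, h]
    simp [h1, h2]

section Walk

variable {V : Type*} [Fintype V] [MeasurableSpace V] [DiscreteMeasurableSpace V]

instance (G : SimpleGraph V) (u : V) : IsProbabilityMeasure (walkLaw G u) := by
  unfold walkLaw; infer_instance

omit [Fintype V] in
theorem measurable_avoids (j : V) (n : ℕ) : Measurable (avoids j n) := by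
  classical
  unfold avoids
  refine Measurable.ite ?_ measurable_const measurable_const
  have : {ω : ℕ → V | ∀ k ≤ n, ω k ≠ j} = ⋂ k, ⋂ (_ : k ≤ n), (fun ω : ℕ → V => ω k) ⁻¹' {j}ᶜ := by
    ext ω; simp
  rw [this]
  exact MeasurableSet.iInter fun k => MeasurableSet.iInter fun _ =>
    measurable_pi_apply k (MeasurableSet.of_discrete)

theorem lintegral_step (G : SimpleGraph V) (x : V) (u : V → ℝ≥0∞) :
    ∫⁻ y, u y ∂(step G x).toMeasure = ∑ y, step G x y * u y := by
  rw [lintegral_fintype]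
  refine Finset.sum_congr rfl fun y _ => ?_
  rw [PMF.toMeasure_apply_singleton _ _ (MeasurableSet.of_discrete), mul_comm]

/-- The Markov property of the walk. -/
theorem lintegral_avoids_succ (G : SimpleGraph V) (i j : V) (n : ℕ) (u : V → ℝ≥0∞) :
    ∫⁻ ω, avoids j n ω * u (ω (n + 1)) ∂(walkLaw G i) =
      ∫⁻ ω, avoids j n ω * ∑ y, step G (ω n) y * u y ∂(walkLaw G i) := by
  classical
  -- Avoidance up to time `n` depends only on the trajectory up to `n`, so the integral can be
  -- disintegrated along the kernel for step `n + 1`.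
  let F : (Π _ : Finset.Iic n, V) → ℝ≥0∞ := fun x => if ∀ k, x k ≠ j then 1 else 0
  have hF : ∀ ω : ℕ → V, avoids j n ω = F (Preorder.frestrictLe n ω) := by
    intro ω
    simp only [avoids, F, Preorder.frestrictLe_apply, Subtype.forall, Finset.mem_Iic]
    congr
  have hFm : Measurable F := measurable_of_countable F
  have hum : Measurable u := measurable_of_countable u
  have key := Kernel.map_frestrictLe_trajMeasure_compProd_eq_map_trajMeasure
    (X := fun _ => V) (μ₀ := Measure.dirac i) (κ := stepKernel G) (a := n)
  have hm : Measurable (fun p : (Π _ : Finset.Iic n, V) × V => F p.1 * u p.2) := by fun_prop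
  have h1 : ∫⁻ ω, avoids j n ω * u (ω (n + 1)) ∂(walkLaw G i) =
      ∫⁻ p, F p.1 * u p.2 ∂((walkLaw G i).map
        (fun x => (Preorder.frestrictLe n x, x (n + 1)))) := by
    rw [lintegral_map hm (by fun_prop)]
    simp only [hF]
  rw [h1]
  unfold walkLaw at *
  rw [← key, Measure.lintegral_compProd hm, lintegral_map (by fun_prop) (by fun_prop)]
  refine lintegral_congr fun ω => ?_
  rw [hF, ← lintegral_step, ← lintegral_const_mul _ hum]
  rfl

theorem walkLaw_map_zero (G : SimpleGraph V) (i : V) :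
    (walkLaw G i).map (fun ω => ω 0) = Measure.dirac i := by
  have h : (walkLaw G i).map (Preorder.frestrictLe 0) =
      (Measure.dirac i).map (MeasurableEquiv.piUnique (fun _ : Finset.Iic 0 => V)).symm := by
    unfold walkLaw Kernel.trajMeasure
    rw [Measure.map_comp _ _ (by fun_prop), Kernel.traj_map_frestrictLe, Kernel.partialTraj_self,
      Measure.id_comp]
  have h2 : (fun ω : ℕ → V => ω 0) =
      (MeasurableEquiv.piUnique (fun _ : Finset.Iic 0 => V)) ∘ (Preorder.frestrictLe 0) := by
    ext ω; rfl
  rw [h2, ← Measure.map_map (by fun_prop) (by fun_prop), h,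
    Measure.map_map (by fun_prop) (by fun_prop)]
  simp

theorem lintegral_avoids_zero (G : SimpleGraph V) (i j : V) (g : V → ℝ≥0∞) (hj : g j = 0) :
    ∫⁻ ω, avoids j 0 ω * g (ω 0) ∂(walkLaw G i) = g i := by
  have h : ∀ ω : ℕ → V, avoids j 0 ω * g (ω 0) = g (ω 0) := by
    intro ω
    unfold avoids
    by_cases hω : ω 0 = j <;> simp [hω, hj]
  have hg : Measurable g := measurable_of_countable g
  simp only [h]
  rw [← lintegral_map (f := g) (g := fun ω : ℕ → V => ω 0) hg (by fun_prop), walkLaw_map_zero,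
    lintegral_dirac' _ hg]

/-- One step of the walk stopped at `j`, tested against a solution of the hitting time equations. -/
theorem lintegral_avoids_mul_eq (G : SimpleGraph V) (i j : V) (g : V → ℝ≥0∞) (hj : g j = 0)
    (hg : ∀ x, x ≠ j → g x = 1 + ∑ y, step G x y * g y) (n : ℕ) :
    ∫⁻ ω, avoids j n ω * g (ω n) ∂(walkLaw G i) = ∫⁻ ω, avoids j n ω ∂(walkLaw G i) +
      ∫⁻ ω, avoids j (n + 1) ω * g (ω (n + 1)) ∂(walkLaw G i) := by
  -- Since `g j = 0`, the extra condition of avoiding `j` at time `n + 1` costs nothing.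
  have h1 : ∀ ω : ℕ → V, avoids j (n + 1) ω * g (ω (n + 1)) = avoids j n ω * g (ω (n + 1)) := by
    intro ω
    by_cases hω : ω (n + 1) = j
    · simp [hω, hj]
    · congr 1
      unfold avoids
      congr 1
      refine propext ⟨fun h k hk => h k (by omega), fun h k hk => ?_⟩
      rcases Nat.lt_or_ge n k with h' | h'
      · obtain rfl : k = n + 1 := by omega
        exact hω
      · exact h k h'
  have h2 : ∀ ω : ℕ → V, avoids j n ω * g (ω n) =
      avoids j n ω + avoids j n ω * ∑ y, step G (ω n) y * g y := by
    intro ω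
    by_cases hω : ω n = j
    · have : avoids j n ω = 0 := by
        unfold avoids
        rw [if_neg]
        exact fun h => h n le_rfl hω
      simp [this]
    · rw [hg _ hω, mul_add, mul_one]
  simp only [h1, h2]
  rw [lintegral_add_left (measurable_avoids j n), lintegral_avoids_succ]

/-- Iterating the one-step identity gives `g i = ∑_{n<N} P(τ > n) + E[g(X_N); τ > N]`, with `τ` the
hitting time of `j`. The partial sums are bounded by the finite number `g i`, so `P(τ > N) → 0`; as
`g` is bounded, the remainder vanishes too. -/
theorem tsum_lintegral_avoids (G : SimpleGraph V) (i j : V) (g : V → ℝ≥0) (hj : g j = 0)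
    (hg : ∀ x, x ≠ j → (g x : ℝ≥0∞) = 1 + ∑ y, step G x y * g y) :
    ∑' n, ∫⁻ ω, avoids j n ω ∂(walkLaw G i) = g i := by
  set p : ℕ → ℝ≥0∞ := fun n => ∫⁻ ω, avoids j n ω ∂(walkLaw G i) with hp
  set a : ℕ → ℝ≥0∞ := fun n => ∫⁻ ω, avoids j n ω * g (ω n) ∂(walkLaw G i) with ha
  have hj' : (fun x => (g x : ℝ≥0∞)) j = 0 := by simp [hj]
  have hrec : ∀ n, a n = p n + a (n + 1) := fun n => lintegral_avoids_mul_eq G i j _ hj' hg n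
  have h0 : a 0 = g i := lintegral_avoids_zero G i j (fun x => (g x : ℝ≥0∞)) hj'
  have hsum : ∀ N, ∑ n ∈ Finset.range N, p n + a N = g i := by
    intro N
    induction N with
    | zero => simpa using h0
    | succ N ih => rw [Finset.sum_range_succ, add_assoc, ← hrec, ih]
  have hle : ∑' n, p n ≤ g i := by
    rw [ENNReal.tsum_eq_iSup_nat]
    exact iSup_le fun N => (hsum N) ▸ le_self_add
  have hfin : ∑' n, p n ≠ ⊤ := ne_top_of_le_ne_top ENNReal.coe_ne_top hle
  have hp0 : Filter.Tendsto p Filter.atTop (nhds 0) := ENNReal.tendsto_atTop_zero_of_tsum_ne_top hfin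
  have hap : ∀ n, a n ≤ (∑ x, g x : ℝ≥0) * p n := by
    intro n
    rw [hp, ha, ← lintegral_const_mul _ (measurable_avoids j n)]
    refine lintegral_mono fun ω => ?_
    rw [mul_comm]
    gcongr
    exact Finset.single_le_sum (fun _ _ => zero_le) (Finset.mem_univ _)
  have ha0 : Filter.Tendsto a Filter.atTop (nhds 0) := by
    refine tendsto_of_tendsto_of_tendsto_of_le_of_le tendsto_const_nhds ?_ (fun _ => zero_le) hap
    simpa using ENNReal.Tendsto.const_mul hp0 (Or.inr (ENNReal.coe_ne_top (r := ∑ x, g x)))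
  have hlim : Filter.Tendsto (fun N => ∑ n ∈ Finset.range N, p n + a N) Filter.atTop
      (nhds (∑' n, p n + 0)) :=
    (ENNReal.summable.hasSum.tendsto_sum_nat).add ha0
  simp only [hsum, add_zero] at hlim
  exact (tendsto_nhds_unique hlim tendsto_const_nhds)

end Walk

/-- A finite solution of the hitting time equations is the mean hitting time. -/
theorem meanHittingTime_eq {V : Type*} [Fintype V] (G : SimpleGraph V) (i j : V) (g : V → ℝ≥0)
    (hj : g j = 0) (hg : ∀ x, x ≠ j → (g x : ℝ≥0∞) = 1 + ∑ y, step G x y * g y) :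
    meanHittingTime G i j = g i := by
  let _ : MeasurableSpace V := ⊤
  have : DiscreteMeasurableSpace V := ⟨fun _ => trivial⟩
  unfold meanHittingTime
  simp only [hittingTime_eq_tsum]
  rw [lintegral_tsum fun n => (measurable_avoids j n).aemeasurable]
  exact tsum_lintegral_avoids G i j g hj hg

/-! ### Laplacian potentials and effective resistance. -/

section Potential

variable {V : Type*}

open Classical in
/-- The adjacency indicator as a real number. -/
noncomputable def adjWeight (G : SimpleGraph V) (x y : V) : ℝ := if G.Adj x y then 1 else 0

theorem adjWeight_comm (G : SimpleGraph V) (x y : V) : adjWeight G x y = adjWeight G y x := by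
  unfold adjWeight
  congr 1
  exact propext (G.adj_comm x y)

variable [Fintype V]

open Classical in
/-- The degree of a vertex as a real number. -/
noncomputable def realDegree (G : SimpleGraph V) (x : V) : ℝ := (G.degree x : ℝ)

theorem realDegree_eq_sum (G : SimpleGraph V) (x : V) :
    realDegree G x = ∑ y, adjWeight G x y := by
  classical
  unfold realDegree adjWeight
  rw [SimpleGraph.degree_eq_sum_if_adj]

theorem realDegree_nonneg (G : SimpleGraph V) (x : V) : 0 ≤ realDegree G x :=
  Nat.cast_nonneg _

theorem sum_realDegree (G : SimpleGraph V) : ∑ x, realDegree G x = 2 * numEdges G := by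
  classical
  unfold realDegree numEdges
  rw [← Nat.cast_sum, SimpleGraph.sum_degrees_eq_twice_card_edges, Nat.cast_mul, Nat.cast_ofNat,
    ← SimpleGraph.coe_edgeFinset, Set.ncard_coe_finset]

open Classical in
/-- The graph Laplacian acting on functions. -/
noncomputable def laplacian (G : SimpleGraph V) (f : V → ℝ) : V → ℝ :=
  Matrix.mulVec (G.lapMatrix ℝ) f

theorem laplacian_apply (G : SimpleGraph V) (f : V → ℝ) (x : V) :
    laplacian G f x = ∑ y, adjWeight G x y * (f x - f y) := by
  classical
  unfold laplacian
  rw [SimpleGraph.lapMatrix_mulVec_apply, SimpleGraph.degree_eq_sum_if_adj, Finset.sum_mul,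
    SimpleGraph.neighborFinset_eq_filter, Finset.sum_filter, ← Finset.sum_sub_distrib]
  refine Finset.sum_congr rfl fun y _ => ?_
  unfold adjWeight
  split_ifs <;> simp

theorem laplacian_apply' (G : SimpleGraph V) (f : V → ℝ) (x : V) :
    laplacian G f x = realDegree G x * f x - ∑ y, adjWeight G x y * f y := by
  simp only [laplacian_apply, realDegree_eq_sum, mul_sub, Finset.sum_sub_distrib, Finset.sum_mul]

theorem sum_laplacian (G : SimpleGraph V) (f : V → ℝ) : ∑ x, laplacian G f x = 0 := by
  have h : ∑ x, laplacian G f x = - ∑ x, laplacian G f x := by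
    simp only [laplacian_apply]
    conv_rhs => rw [Finset.sum_comm]
    rw [← Finset.sum_neg_distrib]
    refine Finset.sum_congr rfl fun x _ => ?_
    rw [← Finset.sum_neg_distrib]
    refine Finset.sum_congr rfl fun y _ => ?_
    rw [adjWeight_comm G x y]; ring
  linarith

theorem eq_of_laplacian_eq_zero {G : SimpleGraph V} (hG : G.Connected) {f : V → ℝ}
    (hf : laplacian G f = 0) (x y : V) : f x = f y := by
  classical
  unfold laplacian at hf
  exact (SimpleGraph.lapMatrix_mulVec_eq_zero_iff_forall_reachable G).1 hf x y (hG x y)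

open Classical in
/-- The bilinear form of the pseudoinverse of the Laplacian. -/
noncomputable def greenForm (G : SimpleGraph V) (s t : V → ℝ) : ℝ :=
  s ⬝ᵥ Matrix.mulVec (pinv (G.lapMatrix ℝ)) t

-- Transposition preserves the Penrose conditions of a symmetric matrix, exchanging the two symmetry
-- conditions; uniqueness does the rest.
open Classical in
theorem pinv_lapMatrix_symm (G : SimpleGraph V) :
    (pinv (G.lapMatrix ℝ)).transpose = pinv (G.lapMatrix ℝ) := by
  have h := isMoorePenrose_pinv (SimpleGraph.isHermitian_lapMatrix ℝ G)
  have hL : (G.lapMatrix ℝ).transpose = G.lapMatrix ℝ := SimpleGraph.isSymm_lapMatrix ℝ G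
  refine IsMoorePenrose.unique (A := G.lapMatrix ℝ) ⟨?_, ?_, ?_, ?_⟩ h
  · have := congrArg Matrix.transpose h.mul_mul_left
    simpa only [Matrix.transpose_mul, hL, Matrix.mul_assoc] using this
  · have := congrArg Matrix.transpose h.mul_mul_right
    simpa only [Matrix.transpose_mul, hL, Matrix.mul_assoc] using this
  · have := congrArg Matrix.transpose h.symm_right
    simpa only [Matrix.transpose_mul, hL, Matrix.transpose_transpose] using this
  · have := congrArg Matrix.transpose h.symm_left
    simpa only [Matrix.transpose_mul, hL, Matrix.transpose_transpose] using this

theorem greenForm_comm (G : SimpleGraph V) (s t : V → ℝ) : greenForm G s t = greenForm G t s := by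
  classical
  unfold greenForm
  rw [Matrix.dotProduct_mulVec, ← Matrix.mulVec_transpose, dotProduct_comm, pinv_lapMatrix_symm]

open Classical in
/-- The solution of the Poisson equation given by the pseudoinverse of the Laplacian. -/
noncomputable def greenApply (G : SimpleGraph V) (t : V → ℝ) : V → ℝ :=
  Matrix.mulVec (pinv (G.lapMatrix ℝ)) t

/-- Transposing `L X L = L` gives `L (L X) = L`, so `L X u - u` lies in the kernel of `L` and is
constant by connectedness. Its entries sum to zero, so it is zero. -/
theorem laplacian_greenApply {G : SimpleGraph V} (hG : G.Connected) {u : V → ℝ}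
    (hu : ∑ x, u x = 0) : laplacian G (greenApply G u) = u := by
  classical
  have h := isMoorePenrose_pinv (SimpleGraph.isHermitian_lapMatrix ℝ G)
  have hL : (G.lapMatrix ℝ).transpose = G.lapMatrix ℝ := SimpleGraph.isSymm_lapMatrix ℝ G
  set X := pinv (G.lapMatrix ℝ) with hX
  have hLLX : G.lapMatrix ℝ * (G.lapMatrix ℝ * X) = G.lapMatrix ℝ := by
    have h1 := congrArg Matrix.transpose h.mul_mul_left
    rw [Matrix.transpose_mul, h.symm_left, hL] at h1
    exact h1
  have hw : laplacian G (laplacian G (greenApply G u) - u) = 0 := by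
    unfold laplacian greenApply
    rw [Matrix.mulVec_sub, Matrix.mulVec_mulVec, Matrix.mulVec_mulVec, ← hX, Matrix.mul_assoc, hLLX,
      sub_self]
  have hc := eq_of_laplacian_eq_zero hG hw
  have hs : ∑ x, (laplacian G (greenApply G u) - u) x = 0 := by
    simp only [Pi.sub_apply, Finset.sum_sub_distrib, sum_laplacian, hu, sub_zero]
  funext x
  have h0 : (Fintype.card V : ℝ) * (laplacian G (greenApply G u) - u) x = 0 := by
    rw [← hs, Finset.sum_congr rfl (fun y _ => hc y x), Finset.sum_const, nsmul_eq_mul,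
      Finset.card_univ]
  have hV : (Fintype.card V : ℝ) ≠ 0 := by
    have : Nonempty V := ⟨x⟩
    exact_mod_cast Fintype.card_ne_zero
  have := (mul_eq_zero.1 h0).resolve_left hV
  simpa [sub_eq_zero] using this

/-- `f` is the potential of a unit current from `a` to `b`: a solution of the weak form of
`L f = e_a - e_b`. -/
def IsPotential (G : SimpleGraph V) (a b : V) (f : V → ℝ) : Prop :=
  ∀ h : V → ℝ, ∑ x, ∑ y, adjWeight G x y * (h x * (f x - f y)) = h a - h b

open Classical in
theorem isPotential_iff {G : SimpleGraph V} {a b : V} {f : V → ℝ} :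
    IsPotential G a b f ↔ laplacian G f = Pi.single a 1 - Pi.single b 1 := by
  have h1 : ∀ h : V → ℝ, ∑ x, ∑ y, adjWeight G x y * (h x * (f x - f y)) = h ⬝ᵥ laplacian G f := by
    intro h
    simp only [dotProduct, laplacian_apply, Finset.mul_sum]
    exact Finset.sum_congr rfl fun x _ => Finset.sum_congr rfl fun y _ => by ring
  have h2 : ∀ h : V → ℝ, h a - h b = h ⬝ᵥ (Pi.single a 1 - Pi.single b 1) := by
    intro h
    simp [dotProduct_sub]
  unfold IsPotential
  simp only [h1, h2]
  constructor
  · intro h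
    exact dotProduct_eq _ _ fun u => by rw [dotProduct_comm, h, dotProduct_comm]
  · intro h u
    rw [h]

/-- `(L f)ᵀ L† (L f) = fᵀ L L† L f = fᵀ L f`. Any potential therefore computes the resistance, and
the pseudoinverse need not be known. -/
theorem IsPotential.resistance_eq {G : SimpleGraph V} {a b : V} {f : V → ℝ}
    (hf : IsPotential G a b f) : resistance G a b = f a - f b := by
  classical
  have h := isMoorePenrose_pinv (SimpleGraph.isHermitian_lapMatrix ℝ G)
  have hL : (G.lapMatrix ℝ).transpose = G.lapMatrix ℝ := SimpleGraph.isSymm_lapMatrix ℝ G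
  have h1 := isPotential_iff.1 hf
  have h3 : resistance G a b =
      greenForm G (Pi.single a 1 - Pi.single b 1) (Pi.single a 1 - Pi.single b 1) := by
    unfold resistance greenForm; rfl
  rw [h3, ← h1]
  unfold greenForm
  have h4 : laplacian G f ⬝ᵥ (Matrix.mulVec (pinv (G.lapMatrix ℝ)) (laplacian G f)) =
      f ⬝ᵥ laplacian G f := by
    unfold laplacian
    rw [Matrix.mulVec_mulVec, dotProduct_comm, Matrix.dotProduct_mulVec, ← Matrix.mulVec_transpose,
      hL, Matrix.mulVec_mulVec, ← Matrix.mul_assoc, h.mul_mul_left, dotProduct_comm]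
  rw [h4, h1]
  simp [dotProduct_sub]

theorem exists_isPotential {G : SimpleGraph V} (hG : G.Connected) (a b : V) :
    ∃ f, IsPotential G a b f := by
  classical
  refine ⟨greenApply G (Pi.single a 1 - Pi.single b 1), isPotential_iff.2 ?_⟩
  rw [laplacian_greenApply hG (by simp [Finset.sum_sub_distrib])]

theorem resistance_self (G : SimpleGraph V) (a : V) : resistance G a a = 0 := by
  simp [resistance]

theorem resistance_comm (G : SimpleGraph V) (a b : V) : resistance G a b = resistance G b a := by
  classical
  unfold resistance
  rw [← neg_sub (Pi.single b 1) (Pi.single a 1), Matrix.mulVec_neg, neg_dotProduct_neg]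

end Potential

/-! ### Kemeny's constant through effective resistances. -/

section Kemeny

variable {V : Type*} [Fintype V]

open Classical in
theorem resistance_eq_greenForm (G : SimpleGraph V) (a b : V) : resistance G a b =
    greenForm G (Pi.single a 1 - Pi.single b 1) (Pi.single a 1 - Pi.single b 1) := rfl

theorem greenForm_sub_left (G : SimpleGraph V) (s t u : V → ℝ) :
    greenForm G (s - t) u = greenForm G s u - greenForm G t u := by
  unfold greenForm; rw [sub_dotProduct]

open Classical in
/-- Polarization of the effective resistance. -/
theorem two_mul_greenForm (G : SimpleGraph V) (i j k : V) :
    2 * greenForm G (Pi.single i 1 - Pi.single j 1) (Pi.single k 1 - Pi.single j 1) =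
      resistance G i j + resistance G k j - resistance G i k := by
  set s : V → ℝ := Pi.single i 1 - Pi.single j 1 with hs
  set t : V → ℝ := Pi.single k 1 - Pi.single j 1 with ht
  have hst : (Pi.single i 1 - Pi.single k 1 : V → ℝ) = s - t := by rw [hs, ht]; abel
  rw [resistance_eq_greenForm, resistance_eq_greenForm, resistance_eq_greenForm, hst, ← hs, ← ht,
    greenForm_sub_left G s t (s - t), greenForm_comm G s (s - t), greenForm_comm G t (s - t),
    greenForm_sub_left G s t s, greenForm_sub_left G s t t, greenForm_comm G t s]
  ring

/-- The mean hitting time of `j` from `i`, in terms of effective resistances. -/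
noncomputable def hitFun (G : SimpleGraph V) (j i : V) : ℝ :=
  (∑ k, realDegree G k * (resistance G i j + resistance G k j - resistance G i k)) / 2

theorem hitFun_self (G : SimpleGraph V) (j : V) : hitFun G j j = 0 := by
  unfold hitFun
  rw [Finset.sum_eq_zero, zero_div]
  intro k _
  rw [resistance_self, resistance_comm G k j]; ring

-- Polarization turns each summand into the form `L†` at `e_i - e_j` and `e_k - e_j`, and `∑ k, d_k
-- (e_k - e_j) = d - 2m e_j` by the handshake lemma.
open Classical in
theorem hitFun_eq_greenApply (G : SimpleGraph V) (i j : V) :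
    hitFun G j i =
      greenApply G (fun x => realDegree G x - if x = j then 2 * numEdges G else 0) i -
      greenApply G (fun x => realDegree G x - if x = j then 2 * numEdges G else 0) j := by
  set u : V → ℝ := fun x => realDegree G x - if x = j then 2 * numEdges G else 0 with hu
  have h1 : u = ∑ k, realDegree G k • (Pi.single k 1 - Pi.single j 1 : V → ℝ) := by
    funext x
    simp only [hu, Finset.sum_apply, Pi.smul_apply, Pi.sub_apply, smul_eq_mul, mul_sub,
      Finset.sum_sub_distrib, ← Finset.sum_mul, sum_realDegree]
    simp [Pi.single_apply]
  have h2 : hitFun G j i = greenForm G (Pi.single i 1 - Pi.single j 1) u := by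
    have : greenForm G (Pi.single i 1 - Pi.single j 1) u = ∑ k, realDegree G k *
        greenForm G (Pi.single i 1 - Pi.single j 1) (Pi.single k 1 - Pi.single j 1) := by
      rw [h1]
      unfold greenForm
      simp only [Matrix.mulVec_sum, dotProduct_sum, Matrix.mulVec_smul, dotProduct_smul,
        smul_eq_mul]
    rw [this]
    unfold hitFun
    rw [Finset.sum_div]
    refine Finset.sum_congr rfl fun k _ => ?_
    rw [← two_mul_greenForm]; ring
  rw [h2, greenForm_sub_left]
  simp [greenForm, greenApply]

-- Away from `j` these are the first-step equations multiplied by the degree. The mass `2m` at `j`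
-- makes the right-hand side sum to zero, as solvability requires.
open Classical in
theorem laplacian_hitFun {G : SimpleGraph V} (hG : G.Connected) (j i : V) :
    laplacian G (hitFun G j) i = realDegree G i - if i = j then 2 * numEdges G else 0 := by
  set u : V → ℝ := fun x => realDegree G x - if x = j then 2 * numEdges G else 0 with hu
  have h1 : laplacian G (hitFun G j) i = laplacian G (greenApply G u) i := by
    simp only [laplacian_apply, hitFun_eq_greenApply, ← hu]
    refine Finset.sum_congr rfl fun y _ => by ring
  rw [h1, laplacian_greenApply hG]
  simp [hu, Finset.sum_sub_distrib, sum_realDegree]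

omit [Fintype V] in
theorem nontrivial_of_numEdges_pos {G : SimpleGraph V} (hm : 0 < numEdges G) : Nontrivial V := by
  by_contra h
  rw [not_nontrivial_iff_subsingleton] at h
  have : G = ⊥ := Subsingleton.elim _ _
  simp [numEdges, this] at hm

theorem realDegree_pos {G : SimpleGraph V} (hG : G.Connected) (hm : 0 < numEdges G) (x : V) :
    0 < realDegree G x := by
  classical
  have := nontrivial_of_numEdges_pos hm
  have h := hG.preconnected.degree_pos_of_nontrivial x
  unfold realDegree
  exact_mod_cast h

theorem step_apply (G : SimpleGraph V) {x : V} (hx : 0 < realDegree G x) (y : V) :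
    step G x y = ENNReal.ofReal (adjWeight G x y / realDegree G x) := by
  classical
  have hd : 0 < G.degree x := by
    unfold realDegree at hx
    exact_mod_cast hx
  have hne : (G.neighborFinset x).Nonempty := by
    rw [← Finset.card_pos]; exact hd
  have hstep : step G x = PMF.uniformOfFinset (G.neighborFinset x) hne := by
    unfold step
    rw [dif_pos]
  rw [hstep, PMF.uniformOfFinset_apply]
  unfold adjWeight
  simp only [SimpleGraph.mem_neighborFinset]
  split_ifs with h
  · rw [ENNReal.ofReal_div_of_pos hx, ENNReal.ofReal_one, one_div]
    congr 1
    unfold realDegree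
    rw [ENNReal.ofReal_natCast]
    rfl
  · simp

theorem hitFun_eq_one_add {G : SimpleGraph V} (hG : G.Connected) (hm : 0 < numEdges G)
    {j x : V} (hx : x ≠ j) :
    hitFun G j x = 1 + ∑ y, adjWeight G x y / realDegree G x * hitFun G j y := by
  have hd := realDegree_pos hG hm x
  have h := laplacian_hitFun hG j x
  rw [if_neg hx, laplacian_apply'] at h
  have h2 : ∑ y, adjWeight G x y / realDegree G x * hitFun G j y =
      (∑ y, adjWeight G x y * hitFun G j y) / realDegree G x := by
    rw [Finset.sum_div]
    exact Finset.sum_congr rfl fun y _ => by ring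
  rw [h2]
  field_simp
  linarith

omit [Fintype V] in
theorem adjWeight_nonneg (G : SimpleGraph V) (x y : V) : 0 ≤ adjWeight G x y := by
  unfold adjWeight; split_ifs <;> norm_num

/-- Minimum principle: at a minimum the Laplacian is at most zero, but off `j` it equals the
positive degree. So the minimum is at `j`, where the value is `0`. -/
theorem hitFun_nonneg {G : SimpleGraph V} (hG : G.Connected) (hm : 0 < numEdges G) (j i : V) :
    0 ≤ hitFun G j i := by
  have : Nonempty V := ⟨j⟩
  obtain ⟨x, hx⟩ := Finite.exists_min (hitFun G j)
  by_cases hxj : x = j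
  · have := hx i
    rwa [hxj, hitFun_self] at this
  · exfalso
    have hd := realDegree_pos hG hm x
    have h := laplacian_hitFun hG j x
    rw [if_neg hxj, laplacian_apply] at h
    have : ∑ y, adjWeight G x y * (hitFun G j x - hitFun G j y) ≤ 0 :=
      Finset.sum_nonpos fun y _ => mul_nonpos_of_nonneg_of_nonpos (adjWeight_nonneg G x y)
        (by linarith [hx y])
    linarith

theorem meanHittingTime_eq_hitFun {G : SimpleGraph V} (hG : G.Connected) (hm : 0 < numEdges G)
    (i j : V) : meanHittingTime G i j = ENNReal.ofReal (hitFun G j i) := by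
  rw [meanHittingTime_eq G i j (fun x => (hitFun G j x).toNNReal) (by simp [hitFun_self])]
  · rfl
  · intro x hx
    have hd := realDegree_pos hG hm x
    have h0 : ∀ y, 0 ≤ adjWeight G x y / realDegree G x :=
      fun y => div_nonneg (adjWeight_nonneg G x y) hd.le
    have h1 : ∀ y, 0 ≤ adjWeight G x y / realDegree G x * hitFun G j y :=
      fun y => mul_nonneg (h0 y) (hitFun_nonneg hG hm j y)
    change ENNReal.ofReal (hitFun G j x) = 1 + ∑ y, step G x y * ENNReal.ofReal (hitFun G j y)
    rw [hitFun_eq_one_add hG hm hx, ENNReal.ofReal_add zero_le_one (Finset.sum_nonneg fun y _ => h1 y),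
      ENNReal.ofReal_one, ENNReal.ofReal_sum_of_nonneg fun y _ => h1 y]
    congr 1
    refine Finset.sum_congr rfl fun y _ => ?_
    rw [step_apply G hd, ENNReal.ofReal_mul (h0 y)]

/-- The quadratic form of the resistance matrix at the degree vector. -/
noncomputable def degreeResistance (G : SimpleGraph V) : ℝ :=
  ∑ x, ∑ y, realDegree G x * (realDegree G y * resistance G x y)

/-- Why Kemeny's constant is constant: summed over `j`, the terms with `r(i,j)` and those with
`r(i,k)` both contribute `2m ∑ k, d_k r(i,k)`, with opposite signs. -/
theorem sum_realDegree_mul_hitFun (G : SimpleGraph V) (i : V) :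
    ∑ j, realDegree G j * hitFun G j i = degreeResistance G / 2 := by
  have h1 : ∀ j, realDegree G j * hitFun G j i =
      (realDegree G j * resistance G i j * (2 * numEdges G)
      + ∑ k, realDegree G j * (realDegree G k * resistance G j k)
      - realDegree G j * ∑ k, realDegree G k * resistance G i k) / 2 := by
    intro j
    unfold hitFun
    rw [← sum_realDegree, Finset.mul_sum, Finset.mul_sum, ← Finset.sum_add_distrib,
      ← Finset.sum_sub_distrib, mul_div_assoc', Finset.mul_sum]
    congr 1
    refine Finset.sum_congr rfl fun k _ => ?_
    rw [resistance_comm G k j]; ring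
  simp only [h1]
  rw [← Finset.sum_div, Finset.sum_sub_distrib, Finset.sum_add_distrib, ← Finset.sum_mul,
    ← Finset.sum_mul, sum_realDegree]
  unfold degreeResistance
  ring

/-- Stationarity of `π` says that `π / d` is harmonic, hence constant on a connected graph; total
mass one fixes the constant as `1 / 2m`. -/
theorem isStationary_iff {G : SimpleGraph V} (hG : G.Connected) (hm : 0 < numEdges G)
    (π : PMF V) :
    IsStationary G π ↔ ∀ x, π x = ENNReal.ofReal (realDegree G x / (2 * numEdges G)) := by
  have hd := realDegree_pos hG hm
  have hbind : ∀ y, π.bind (step G) y =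
      ENNReal.ofReal (∑ x, adjWeight G y x * ((π x).toReal / realDegree G x)) := by
    intro y
    rw [PMF.bind_apply, tsum_fintype, ENNReal.ofReal_sum_of_nonneg]
    · refine Finset.sum_congr rfl fun x _ => ?_
      rw [step_apply G (hd x), adjWeight_comm G y x, mul_div_left_comm,
        ENNReal.ofReal_mul ENNReal.toReal_nonneg, ENNReal.ofReal_toReal (π.apply_ne_top x)]
    · intro x _
      exact mul_nonneg (adjWeight_nonneg G y x) (div_nonneg ENNReal.toReal_nonneg (hd x).le)
  constructor
  · intro h
    have hL : laplacian G (fun x => (π x).toReal / realDegree G x) = 0 := by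
      funext y
      have h1 : (π y).toReal = ∑ x, adjWeight G y x * ((π x).toReal / realDegree G x) := by
        have := congrArg ENNReal.toReal (hbind y)
        rw [h, ENNReal.toReal_ofReal] at this
        · exact this
        · exact Finset.sum_nonneg fun x _ => mul_nonneg (adjWeight_nonneg G y x)
            (div_nonneg ENNReal.toReal_nonneg (hd x).le)
      rw [laplacian_apply', ← h1, mul_div_cancel₀ _ (hd y).ne', sub_self, Pi.zero_apply]
    have hc := eq_of_laplacian_eq_zero hG hL
    intro x
    have hsum : ∑ y, (π y).toReal = 1 := by
      rw [← ENNReal.toReal_sum fun y _ => π.apply_ne_top y, (tsum_fintype _).symm.trans π.tsum_coe,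
        ENNReal.toReal_one]
    have h2 : ∀ y, (π y).toReal = realDegree G y * ((π x).toReal / realDegree G x) := by
      intro y
      rw [hc x y, mul_div_cancel₀ _ (hd y).ne']
    rw [Finset.sum_congr rfl fun y _ => h2 y] at hsum
    rw [← Finset.sum_mul, sum_realDegree] at hsum
    rw [← ENNReal.ofReal_toReal (π.apply_ne_top x)]
    congr 1
    have := hd x
    field_simp at hsum ⊢
    linarith
  · intro h
    refine PMF.ext fun y => ?_
    rw [hbind, h]
    congr 1
    rw [realDegree_eq_sum, Finset.sum_div]
    refine Finset.sum_congr rfl fun x _ => ?_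
    have := hd x
    rw [h, ENNReal.toReal_ofReal (by positivity)]
    field_simp

theorem exists_stationary {G : SimpleGraph V} (hm : 0 < numEdges G) :
    ∃ π : PMF V, ∀ x, π x = ENNReal.ofReal (realDegree G x / (2 * numEdges G)) := by
  refine ⟨PMF.ofFintype (fun x => ENNReal.ofReal (realDegree G x / (2 * numEdges G))) ?_,
    fun x => rfl⟩
  rw [← ENNReal.ofReal_sum_of_nonneg, ← Finset.sum_div, sum_realDegree, div_self (by positivity),
    ENNReal.ofReal_one]
  intro x _
  exact div_nonneg (realDegree_nonneg G x) (by positivity)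

theorem isKemenyConstant_of_pos {G : SimpleGraph V} (hG : G.Connected) (hm : 0 < numEdges G) :
    ∃ K : ℝ≥0, IsKemenyConstant G K ∧ 4 * numEdges G * K = degreeResistance G := by
  obtain ⟨π, hπ⟩ := exists_stationary hm
  have hsum : ∀ i, ∑ j, π j * meanHittingTime G i j =
      ENNReal.ofReal (degreeResistance G / (4 * numEdges G)) := by
    intro i
    have h1 : degreeResistance G / (4 * numEdges G) =
        ∑ j, realDegree G j / (2 * numEdges G) * hitFun G j i := by
      have := sum_realDegree_mul_hitFun G i
      have h2 : ∑ j, realDegree G j / (2 * numEdges G) * hitFun G j i =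
          (∑ j, realDegree G j * hitFun G j i) / (2 * numEdges G) := by
        rw [Finset.sum_div]
        exact Finset.sum_congr rfl fun y _ => by ring
      rw [h2, this]
      field_simp
      norm_num
    have h3 : ∀ j, 0 ≤ realDegree G j / (2 * numEdges G) :=
      fun j => div_nonneg (realDegree_nonneg G j) (by positivity)
    rw [h1, ENNReal.ofReal_sum_of_nonneg fun j _ => mul_nonneg (h3 j) (hitFun_nonneg hG hm j i)]
    refine Finset.sum_congr rfl fun j _ => ?_
    rw [hπ, meanHittingTime_eq_hitFun hG hm, ENNReal.ofReal_mul (h3 j)]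
  refine ⟨(degreeResistance G / (4 * numEdges G)).toNNReal,
    ⟨π, (isStationary_iff hG hm π).2 hπ, ?_, hsum⟩, ?_⟩
  · intro π' h'
    refine PMF.ext fun x => ?_
    rw [(isStationary_iff hG hm π').1 h', hπ]
  · have hn : 0 ≤ degreeResistance G := by
      obtain ⟨i⟩ := hG.nonempty
      have h := sum_realDegree_mul_hitFun G i
      have : 0 ≤ ∑ j, realDegree G j * hitFun G j i := Finset.sum_nonneg fun j _ =>
        mul_nonneg (realDegree_nonneg G j) (hitFun_nonneg hG hm j i)
      linarith
    rw [Real.coe_toNNReal _ (by positivity)]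
    field_simp

theorem isKemenyConstant_zero_of_subsingleton [Subsingleton V] [Nonempty V] (G : SimpleGraph V) :
    IsKemenyConstant G 0 := by
  obtain ⟨v⟩ := ‹Nonempty V›
  have hpmf : ∀ π π' : PMF V, π = π' := by
    have h1 : ∀ π : PMF V, ∀ x, π x = 1 := by
      intro π x
      have := π.tsum_coe
      rwa [tsum_eq_single x fun y hy => absurd (Subsingleton.elim y x) hy] at this
    intro π π'
    exact PMF.ext fun x => by rw [h1, h1]
  refine ⟨PMF.pure v, hpmf _ _, fun π' _ => hpmf _ _, fun i => ?_⟩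
  refine Finset.sum_eq_zero fun j _ => ?_
  rw [meanHittingTime_eq G i j 0 rfl fun x hx => absurd (Subsingleton.elim x j) hx]
  simp

/-- The form without division also covers the edgeless case: a connected graph without edges has one
vertex, and both sides are zero. -/
theorem exists_isKemenyConstant {G : SimpleGraph V} (hG : G.Connected) :
    ∃ K : ℝ≥0, IsKemenyConstant G K ∧ 4 * numEdges G * K = degreeResistance G := by
  have h0 : 0 ≤ numEdges G := Nat.cast_nonneg _
  rcases h0.lt_or_eq with hm | hm
  · exact isKemenyConstant_of_pos hG hm
  · have hV : Subsingleton V := by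
      by_contra h
      rw [not_subsingleton_iff_nontrivial] at h
      classical
      obtain ⟨v⟩ := hG.nonempty
      have h1 := hG.preconnected.degree_pos_of_nontrivial v
      have h2 := sum_realDegree G
      rw [← hm, mul_zero, Finset.sum_eq_zero_iff_of_nonneg fun x _ => realDegree_nonneg G x] at h2
      have h3 := h2 v (Finset.mem_univ v)
      unfold realDegree at h3
      rw [Nat.cast_eq_zero] at h3
      exact h1.ne' h3
    have := hG.nonempty
    refine ⟨0, isKemenyConstant_zero_of_subsingleton G, ?_⟩
    unfold degreeResistance
    rw [NNReal.coe_zero, mul_zero, Finset.sum_eq_zero]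
    intro x _
    refine Finset.sum_eq_zero fun y _ => ?_
    rw [Subsingleton.elim x y, resistance_self, mul_zero, mul_zero]

theorem IsKemenyConstant.unique [Nonempty V] {G : SimpleGraph V} {K K' : ℝ≥0}
    (h : IsKemenyConstant G K) (h' : IsKemenyConstant G K') : K = K' := by
  obtain ⟨i⟩ := ‹Nonempty V›
  obtain ⟨π, -, hu, hK⟩ := h
  obtain ⟨π', hs', -, hK'⟩ := h'
  obtain rfl := hu π' hs'
  have := (hK i).symm.trans (hK' i)
  exact_mod_cast this

theorem isKemenyConstant_kemeny {G : SimpleGraph V} (hG : G.Connected) :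
    IsKemenyConstant G (kemeny G) := by
  obtain ⟨K, hK, -⟩ := exists_isKemenyConstant hG
  exact Classical.epsilon_spec (p := IsKemenyConstant G) ⟨K, hK⟩

/-- Kemeny's constant in terms of degrees and effective resistances. -/
theorem four_mul_numEdges_mul_kemeny {G : SimpleGraph V} (hG : G.Connected) :
    4 * numEdges G * kemeny G = degreeResistance G := by
  have := hG.nonempty
  obtain ⟨K, hK, h⟩ := exists_isKemenyConstant hG
  rw [(isKemenyConstant_kemeny hG).unique hK, h]

end Kemeny

/-! ### Potentials and resistances in a 1-sum. -/

section OneSum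

variable {V W : Type*}

theorem oneSumLeft_self (v₁ : V) (v₂ : W) : oneSumLeft v₁ v₂ v₁ = Sum.inr v₂ := by
  simp [oneSumLeft]

theorem oneSumLeft_coe (v₁ : V) (v₂ : W) (x : {x : V // x ≠ v₁}) :
    oneSumLeft v₁ v₂ x = Sum.inl x := by
  simp [oneSumLeft, x.2]

theorem oneSumLeft_of_ne {v₁ : V} (v₂ : W) {x : V} (hx : x ≠ v₁) :
    oneSumLeft v₁ v₂ x = Sum.inl ⟨x, hx⟩ := by
  simp [oneSumLeft, hx]

variable (G₁ : SimpleGraph V) (v₁ : V) (G₂ : SimpleGraph W) (v₂ : W)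

theorem oneSum_adj_left {x y : V} (h : G₁.Adj x y) :
    (oneSum G₁ v₁ G₂ v₂).Adj (oneSumLeft v₁ v₂ x) (oneSumLeft v₁ v₂ y) := by
  by_cases hx : x = v₁
  · by_cases hy : y = v₁
    · exact absurd h (by rw [hx, hy]; exact G₁.loopless.irrefl _)
    · rw [hx, oneSumLeft_self, oneSumLeft_of_ne v₂ hy]
      exact ⟨rfl, hx ▸ h.symm⟩
  · by_cases hy : y = v₁
    · rw [hy, oneSumLeft_self, oneSumLeft_of_ne v₂ hx]
      exact ⟨rfl, hy ▸ h⟩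
    · rw [oneSumLeft_of_ne v₂ hx, oneSumLeft_of_ne v₂ hy]
      exact h

variable {G₁ G₂} in
theorem oneSum_connected (h₁ : G₁.Connected) (h₂ : G₂.Connected) :
    (oneSum G₁ v₁ G₂ v₂).Connected := by
  let f₁ : G₁ →g oneSum G₁ v₁ G₂ v₂ := ⟨oneSumLeft v₁ v₂, oneSum_adj_left G₁ v₁ G₂ v₂⟩
  let f₂ : G₂ →g oneSum G₁ v₁ G₂ v₂ := ⟨Sum.inr, fun h => h⟩
  have key : ∀ z, (oneSum G₁ v₁ G₂ v₂).Reachable z (Sum.inr v₂) := by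
    rintro (x | y)
    · have := (h₁ x v₁).map f₁
      change (oneSum G₁ v₁ G₂ v₂).Reachable (oneSumLeft v₁ v₂ x) (oneSumLeft v₁ v₂ v₁) at this
      rwa [oneSumLeft_self, oneSumLeft_coe] at this
    · exact (h₂ y v₂).map f₂
  have : Nonempty ({x : V // x ≠ v₁} ⊕ W) := ⟨Sum.inr v₂⟩
  exact ⟨fun x y => (key x).trans (key y).symm⟩

variable [Fintype V] [Fintype W] [Fintype {x : V // x ≠ v₁}]

/-- The adjacencies of a 1-sum are those of its two summands. -/
theorem sum_adjWeight_oneSum (F : {x : V // x ≠ v₁} ⊕ W → {x : V // x ≠ v₁} ⊕ W → ℝ) :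
    ∑ x, ∑ y, adjWeight (oneSum G₁ v₁ G₂ v₂) x y * F x y =
      ∑ x, ∑ y, adjWeight G₁ x y * F (oneSumLeft v₁ v₂ x) (oneSumLeft v₁ v₂ y) +
      ∑ x, ∑ y, adjWeight G₂ x y * F (Sum.inr x) (Sum.inr y) := by
  classical
  -- With `v₁` split off from the sums over `V`, its row and column become the edges between the two
  -- sides of the 1-sum, all of which end at `v₂`.
  have hs : ∀ f : V → ℝ, ∑ x, f x = f v₁ + ∑ x : {x : V // x ≠ v₁}, f x := by
    intro f
    rw [Fintype.sum_eq_add_sum_subtype_ne f v₁]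
    congr 2
    exact Finset.ext fun x => by simp
  have hll : ∀ x y, adjWeight (oneSum G₁ v₁ G₂ v₂) (Sum.inl x) (Sum.inl y) =
      adjWeight G₁ x y := fun x y => rfl
  have hrr : ∀ x y, adjWeight (oneSum G₁ v₁ G₂ v₂) (Sum.inr x) (Sum.inr y) =
      adjWeight G₂ x y := fun x y => rfl
  have hlr : ∀ x y, adjWeight (oneSum G₁ v₁ G₂ v₂) (Sum.inl x) (Sum.inr y) =
      if y = v₂ then adjWeight G₁ x v₁ else 0 := by
    intro x y
    have h : (oneSum G₁ v₁ G₂ v₂).Adj (Sum.inl x) (Sum.inr y) ↔ y = v₂ ∧ G₁.Adj x v₁ := Iff.rfl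
    unfold adjWeight
    simp only [h, ite_and]
  have hrl : ∀ x y, adjWeight (oneSum G₁ v₁ G₂ v₂) (Sum.inr x) (Sum.inl y) =
      if x = v₂ then adjWeight G₁ v₁ y else 0 := by
    intro x y
    rw [adjWeight_comm, hlr, adjWeight_comm G₁]
  have h0 : adjWeight G₁ v₁ v₁ = 0 := by simp [adjWeight]
  rw [hs]
  simp only [hs, Fintype.sum_sum_type, hll, hrr, hlr, hrl, oneSumLeft_self, oneSumLeft_coe, h0,
    ite_mul, zero_mul, Finset.sum_add_distrib, Finset.sum_ite_eq', Finset.mem_univ, if_true]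
  have h1 : ∑ x : W, ∑ y : {x : V // x ≠ v₁}, (if x = v₂ then
      adjWeight G₁ v₁ y * F (Sum.inr x) (Sum.inl y) else 0) =
      ∑ y : {x : V // x ≠ v₁}, adjWeight G₁ v₁ y * F (Sum.inr v₂) (Sum.inl y) := by
    rw [Finset.sum_comm]
    simp
  rw [h1]
  ring

theorem sum_realDegree_oneSum (F : {x : V // x ≠ v₁} ⊕ W → ℝ) :
    ∑ x, realDegree (oneSum G₁ v₁ G₂ v₂) x * F x =
      ∑ x, realDegree G₁ x * F (oneSumLeft v₁ v₂ x) + ∑ x, realDegree G₂ x * F (Sum.inr x) := by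
  simp only [realDegree_eq_sum, Finset.sum_mul]
  exact sum_adjWeight_oneSum G₁ v₁ G₂ v₂ fun x _ => F x

variable {G₁ G₂ v₁ v₂}

/-- Extended by its value at the cut vertex, the potential drives no current in the other summand.
In the weak form the check is immediate: the energy sum splits, and a test function on the 1-sum
pulls back to `G₁`. -/
theorem IsPotential.oneSum_left {a b : V} {f : V → ℝ} (hf : IsPotential G₁ a b f) :
    IsPotential (oneSum G₁ v₁ G₂ v₂) (oneSumLeft v₁ v₂ a) (oneSumLeft v₁ v₂ b)
      (Sum.elim (fun x => f x) fun _ => f v₁) := by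
  have hl : ∀ x, Sum.elim (fun x : {x : V // x ≠ v₁} => f x) (fun _ : W => f v₁)
      (oneSumLeft v₁ v₂ x) = f x := by
    intro x
    by_cases hx : x = v₁
    · rw [hx, oneSumLeft_self]; rfl
    · rw [oneSumLeft_of_ne v₂ hx]; rfl
  intro h
  rw [sum_adjWeight_oneSum G₁ v₁ G₂ v₂ fun x y => h x * (_ - _)]
  simp only [hl, Sum.elim_inr, sub_self, mul_zero, Finset.sum_const_zero, add_zero]
  exact hf fun x => h (oneSumLeft v₁ v₂ x)

theorem IsPotential.oneSum_right {a b : W} {f : W → ℝ} (hf : IsPotential G₂ a b f) :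
    IsPotential (oneSum G₁ v₁ G₂ v₂) (Sum.inr a) (Sum.inr b) (Sum.elim (fun _ => f v₂) f) := by
  have hl : ∀ x, Sum.elim (fun _ : {x : V // x ≠ v₁} => f v₂) f
      (oneSumLeft v₁ v₂ x) = f v₂ := by
    intro x
    by_cases hx : x = v₁
    · rw [hx, oneSumLeft_self]; rfl
    · rw [oneSumLeft_of_ne v₂ hx]; rfl
  intro h
  rw [sum_adjWeight_oneSum G₁ v₁ G₂ v₂ fun x y => h x * (_ - _)]
  simp only [hl, Sum.elim_inr, sub_self, mul_zero, Finset.sum_const_zero, zero_add]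
  exact hf fun x => h (Sum.inr x)

omit [Fintype W] in
theorem IsPotential.trans {G : SimpleGraph V} {a b c : V} {f g : V → ℝ} (hf : IsPotential G a b f)
    (hg : IsPotential G b c g) : IsPotential G a c (f + g) := by
  intro h
  have := congrArg₂ (· + ·) (hf h) (hg h)
  simp only [← Finset.sum_add_distrib] at this
  rw [sub_add_sub_cancel] at this
  rw [← this]
  refine Finset.sum_congr rfl fun x _ => Finset.sum_congr rfl fun y _ => ?_
  simp only [Pi.add_apply]
  ring

theorem resistance_oneSum_left (h₁ : G₁.Connected) (a b : V) :
    resistance (oneSum G₁ v₁ G₂ v₂) (oneSumLeft v₁ v₂ a) (oneSumLeft v₁ v₂ b) =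
      resistance G₁ a b := by
  obtain ⟨f, hf⟩ := exists_isPotential h₁ a b
  have hl : ∀ x, Sum.elim (fun x : {x : V // x ≠ v₁} => f x) (fun _ : W => f v₁)
      (oneSumLeft v₁ v₂ x) = f x := by
    intro x
    by_cases hx : x = v₁
    · rw [hx, oneSumLeft_self]; rfl
    · rw [oneSumLeft_of_ne v₂ hx]; rfl
  rw [hf.oneSum_left.resistance_eq, hf.resistance_eq, hl, hl]

theorem resistance_oneSum_right (h₂ : G₂.Connected) (a b : W) :
    resistance (oneSum G₁ v₁ G₂ v₂) (Sum.inr a) (Sum.inr b) = resistance G₂ a b := by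
  obtain ⟨f, hf⟩ := exists_isPotential h₂ a b
  rw [hf.oneSum_right.resistance_eq, hf.resistance_eq]
  rfl

/-- Effective resistances add up across a cut vertex. -/
theorem resistance_oneSum (h₁ : G₁.Connected) (h₂ : G₂.Connected) (a : V) (b : W) :
    resistance (oneSum G₁ v₁ G₂ v₂) (oneSumLeft v₁ v₂ a) (Sum.inr b) =
      resistance G₁ a v₁ + resistance G₂ v₂ b := by
  obtain ⟨f, hf⟩ := exists_isPotential h₁ a v₁
  obtain ⟨g, hg⟩ := exists_isPotential h₂ v₂ b
  -- Series law: superpose the unit current from `a` to the cut vertex and the one from there to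
  -- `b`; each potential is constant on the side it does not use.
  have hf' := hf.oneSum_left (G₂ := G₂) (v₁ := v₁) (v₂ := v₂)
  have hg' := hg.oneSum_right (G₁ := G₁) (v₁ := v₁) (v₂ := v₂)
  rw [oneSumLeft_self] at hf'
  rw [(hf'.trans hg').resistance_eq, hf.resistance_eq, hg.resistance_eq]
  by_cases ha : a = v₁
  · rw [ha, oneSumLeft_self]; simp
  · rw [oneSumLeft_of_ne v₂ ha]; simp; ring

end OneSum

/-! ### Resistances along a chain. -/

open Classical in
/-- Attach one more block to a chain. -/
noncomputable def Glued.snoc {n : ℕ} (B : Fin (n + 2) → Block.{u})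
    (C : Glued fun k : Fin (n + 1) => B k.castSucc) : Glued B :=
  let c : C.V := C.emb (Fin.last n) (B (Fin.last n).castSucc).right
  { V := {x : C.V // x ≠ c} ⊕ (B (Fin.last (n + 1))).V
    graph := oneSum C.graph c (B (Fin.last (n + 1))).graph (B (Fin.last (n + 1))).left
    emb := Fin.lastCases (fun x => Sum.inr x)
      (fun k x => oneSumLeft c (B (Fin.last (n + 1))).left (C.emb k x)) }

/-- Isolates the recursive step, so that the induction can treat the shorter chain as an arbitrary
`Glued` satisfying `IsChain`. -/
theorem chain_succ {n : ℕ} (B : Fin (n + 2) → Block.{u}) :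
    chain B = Glued.snoc B (chain fun k : Fin (n + 1) => B k.castSucc) := rfl

theorem Glued.snoc_emb_last {n : ℕ} (B : Fin (n + 2) → Block.{u})
    (C : Glued fun k : Fin (n + 1) => B k.castSucc) (x : (B (Fin.last (n + 1))).V) :
    (Glued.snoc B C).emb (Fin.last (n + 1)) x = Sum.inr x := by
  unfold Glued.snoc
  simp only [Fin.lastCases_last]

theorem Glued.snoc_emb_castSucc {n : ℕ} (B : Fin (n + 2) → Block.{u})
    (C : Glued fun k : Fin (n + 1) => B k.castSucc) (k : Fin (n + 1)) (x : (B k.castSucc).V) :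
    (Glued.snoc B C).emb k.castSucc x = oneSumLeft
      (C.emb (Fin.last n) (B (Fin.last n).castSucc).right) (B (Fin.last (n + 1))).left
        (C.emb k x) := by
  unfold Glued.snoc
  simp only [Fin.lastCases_castSucc]

/-- The metric properties of a chain of 1-sums. -/
structure Glued.IsChain {n : ℕ} {B : Fin (n + 1) → Block.{u}} (C : Glued B) : Prop where
  connected : C.graph.Connected
  sum_degree : ∀ F : C.V → ℝ, ∑ x, realDegree C.graph x * F x =
    ∑ k, ∑ y, realDegree (B k).graph y * F (C.emb k y)
  resistance_emb : ∀ k x y,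
    resistance C.graph (C.emb k x) (C.emb k y) = resistance (B k).graph x y
  resistance_emb_lt : ∀ i j, i < j → ∀ x y, resistance C.graph (C.emb i x) (C.emb j y) =
    resistance (B i).graph x (B i).right +
      resistance C.graph (C.emb i (B i).right) (C.emb j (B j).left) +
      resistance (B j).graph (B j).left y
  glue : ∀ i j : Fin (n + 1), i.val + 1 = j.val → C.emb i (B i).right = C.emb j (B j).left

/-- Old resistances persist, and a resistance from an old vertex to the new block splits at `c`, the
right vertex of the last old block. So only resistances to `c` need decomposing. -/
theorem Glued.IsChain.snoc {n : ℕ} {B : Fin (n + 2) → Block.{u}}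
    {C : Glued fun k : Fin (n + 1) => B k.castSucc} (hC : C.IsChain)
    (hB : (B (Fin.last (n + 1))).graph.Connected) : (Glued.snoc B C).IsChain := by
  classical
  set c : C.V := C.emb (Fin.last n) (B (Fin.last n).castSucc).right with hc
  have hLL : ∀ a b : C.V, resistance (Glued.snoc B C).graph
      (oneSumLeft c (B (Fin.last (n + 1))).left a) (oneSumLeft c (B (Fin.last (n + 1))).left b) =
      resistance C.graph a b := fun a b => resistance_oneSum_left hC.connected a b
  have hLR : ∀ (a : C.V) (b : (B (Fin.last (n + 1))).V), resistance (Glued.snoc B C).graph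
      (oneSumLeft c (B (Fin.last (n + 1))).left a) (Sum.inr b) = resistance C.graph a c +
        resistance (B (Fin.last (n + 1))).graph (B (Fin.last (n + 1))).left b :=
    fun a b => resistance_oneSum hC.connected hB a b
  have hRR : ∀ a b : (B (Fin.last (n + 1))).V, resistance (Glued.snoc B C).graph
      (Sum.inr a) (Sum.inr b) = resistance (B (Fin.last (n + 1))).graph a b :=
    fun a b => resistance_oneSum_right hB a b
  refine ⟨oneSum_connected _ _ hC.connected hB, fun F => ?_, fun k => ?_, fun i j => ?_,
    fun i j => ?_⟩
  · rw [Fin.sum_univ_castSucc]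
    simp only [Glued.snoc_emb_last, Glued.snoc_emb_castSucc]
    rw [← hC.sum_degree fun x => F (oneSumLeft c (B (Fin.last (n + 1))).left x)]
    exact sum_realDegree_oneSum C.graph c (B (Fin.last (n + 1))).graph
      (B (Fin.last (n + 1))).left F
  · refine Fin.lastCases ?_ (fun k => ?_) k
    · intro x y
      rw [Glued.snoc_emb_last, Glued.snoc_emb_last, hRR]
    · intro x y
      rw [Glued.snoc_emb_castSucc, Glued.snoc_emb_castSucc, hLL, hC.resistance_emb]
  · refine Fin.lastCases (fun hij => ?_) (fun i => ?_) i
    · exact absurd hij (not_lt.2 (Fin.le_last j))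
    · refine Fin.lastCases (fun _ x y => ?_) (fun j hij x y => ?_) j
      · rw [Glued.snoc_emb_last, Glued.snoc_emb_castSucc, Glued.snoc_emb_castSucc,
          Glued.snoc_emb_last, hLR, hLR, resistance_self, add_zero]
        congr 1
        -- What remains is to split `r(x, c)` at the right vertex of block `i`. For an earlier block
        -- the decomposition in `C` is used for both `x` and that right vertex; for the last one `c`
        -- is itself the right vertex.
        rcases (Fin.le_last i).lt_or_eq with hi | rfl
        · rw [hc, hC.resistance_emb_lt i _ hi x (B (Fin.last n).castSucc).right,
            hC.resistance_emb_lt i _ hi (B i.castSucc).right (B (Fin.last n).castSucc).right,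
            resistance_self]
          ring
        · rw [hc, hC.resistance_emb, hC.resistance_emb, resistance_self, add_zero]
      · rw [Glued.snoc_emb_castSucc, Glued.snoc_emb_castSucc, Glued.snoc_emb_castSucc,
          Glued.snoc_emb_castSucc, hLL, hLL]
        exact hC.resistance_emb_lt i j (Fin.castSucc_lt_castSucc_iff.1 hij) x y
  · refine Fin.lastCases (fun hij => ?_) (fun i => ?_) i
    · have := j.isLt
      simp only [Fin.val_last] at hij
      omega
    · refine Fin.lastCases (fun hij => ?_) (fun j hij => ?_) j
      · obtain rfl : i = Fin.last n := by
          ext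
          simpa using hij
        rw [Glued.snoc_emb_castSucc, Glued.snoc_emb_last, oneSumLeft_self]
      · rw [Glued.snoc_emb_castSucc, Glued.snoc_emb_castSucc,
          hC.glue i j (by simpa using hij)]

theorem isChain_chain {n : ℕ} (B : Fin (n + 1) → Block.{u}) (hB : ∀ k, (B k).graph.Connected) :
    (chain B).IsChain := by
  induction n with
  | zero =>
    have h0 : ∀ i : Fin 1, i = 0 := fun i => Subsingleton.elim i 0
    refine ⟨hB 0, fun F => ?_, fun k x y => ?_, fun i j hij => ?_, fun i j hij => ?_⟩
    · rw [Fin.sum_univ_one]; rfl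
    · obtain rfl := h0 k; rfl
    · rw [h0 i, h0 j] at hij
      exact absurd hij (lt_irrefl _)
    · omega
  | succ n ih =>
    rw [chain_succ]
    exact (ih _ fun k => hB k.castSucc).snoc (hB _)

/-! ### Blockwise decomposition of the degree-resistance form. -/

theorem graphMoment_eq {V : Type*} [Fintype V] (G : SimpleGraph V) (v : V) :
    graphMoment G v = ∑ x, realDegree G x * resistance G x v := rfl

namespace Glued

variable {n : ℕ} {B : Fin (n + 1) → Block.{u}}

/-- The contribution of a pair of blocks to `degreeResistance`. -/
noncomputable def blockResistance (C : Glued B) (i j : Fin (n + 1)) : ℝ :=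
  ∑ x, ∑ y, realDegree (B i).graph x *
    (realDegree (B j).graph y * resistance C.graph (C.emb i x) (C.emb j y))

theorem blockResistance_comm (C : Glued B) (i j : Fin (n + 1)) :
    C.blockResistance i j = C.blockResistance j i := by
  unfold blockResistance
  rw [Finset.sum_comm]
  refine Finset.sum_congr rfl fun x _ => Finset.sum_congr rfl fun y _ => ?_
  rw [resistance_comm C.graph (C.emb i y)]
  ring

variable {C : Glued B}

theorem IsChain.numEdges_eq (hC : C.IsChain) : numEdges C.graph = ∑ k, numEdges (B k).graph := by
  have h := hC.sum_degree fun _ => 1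
  simp only [mul_one, sum_realDegree, ← Finset.mul_sum] at h
  linarith

theorem IsChain.degreeResistance_eq (hC : C.IsChain) :
    degreeResistance C.graph = ∑ i, ∑ j, C.blockResistance i j := by
  unfold degreeResistance blockResistance
  simp only [← Finset.mul_sum]
  rw [hC.sum_degree]
  refine Finset.sum_congr rfl fun i _ => ?_
  rw [Finset.sum_comm]
  refine Finset.sum_congr rfl fun x _ => ?_
  rw [hC.sum_degree, Finset.mul_sum]

theorem IsChain.blockResistance_self (hC : C.IsChain) (i : Fin (n + 1)) :
    C.blockResistance i i = degreeResistance (B i).graph := by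
  unfold degreeResistance blockResistance
  simp only [hC.resistance_emb]

/-- Each of the three pieces of `r(x,y)` involves at most one of `x` and `y`; every free variable
sums to a total degree `2m`, and every other one to a moment. -/
theorem IsChain.blockResistance_lt (hC : C.IsChain) {i j : Fin (n + 1)} (hij : i < j) :
    C.blockResistance i j =
      2 * (numEdges (B i).graph * graphMoment (B j).graph (B j).left) +
      2 * (numEdges (B j).graph * graphMoment (B i).graph (B i).right) +
      4 * (numEdges (B i).graph * numEdges (B j).graph *
        resistance C.graph (C.emb i (B i).right) (C.emb j (B j).left)) := by
  unfold blockResistance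
  set ρ := resistance C.graph (C.emb i (B i).right) (C.emb j (B j).left)
  have h1 : ∀ x y, realDegree (B i).graph x *
      (realDegree (B j).graph y * resistance C.graph (C.emb i x) (C.emb j y)) =
      (realDegree (B i).graph x * resistance (B i).graph x (B i).right) * realDegree (B j).graph y
      + realDegree (B i).graph x * ρ * realDegree (B j).graph y
      + realDegree (B i).graph x *
        (realDegree (B j).graph y * resistance (B j).graph y (B j).left) := by
    intro x y
    rw [hC.resistance_emb_lt i j hij, resistance_comm (B j).graph (B j).left y]
    ring
  simp only [h1, Finset.sum_add_distrib, ← Finset.mul_sum, ← Finset.sum_mul, sum_realDegree,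
    graphMoment_eq]
  ring

end Glued

end KemenyChain

/-! ### Assembly of the formula. -/

theorem mainTheorem2 {n : ℕ} (B : Fin (n + 1) → Block.{u})
    (hconn : ∀ k, (B k).graph.Connected)
    (hedge : 0 < ∑ k, numEdges (B k).graph) :
    IsKemenyConstant (chain B).graph (kemeny (chain B).graph) ∧
    (∀ k, IsKemenyConstant (B k).graph (kemeny (B k).graph)) ∧
    (kemeny (chain B).graph : ℝ) =
      ((∑ i, numEdges (B i).graph *
          ((kemeny (B i).graph : ℝ) +
            ∑ j with j ≠ i,
              graphMoment (B j).graph (if i < j then (B j).left else (B j).right)))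
        + 2 * ∑ i, ∑ j with i.val + 2 ≤ j.val,
            numEdges (B i).graph * numEdges (B j).graph *
              resistance (chain B).graph
                ((chain B).emb i (B i).right) ((chain B).emb j (B j).left))
      / ∑ i, numEdges (B i).graph := by
  have hC := isChain_chain B hconn
  refine ⟨isKemenyConstant_kemeny hC.connected, fun k => isKemenyConstant_kemeny (hconn k), ?_⟩
  rw [eq_div_iff hedge.ne']
  have hK := four_mul_numEdges_mul_kemeny hC.connected
  rw [hC.degreeResistance_eq, hC.numEdges_eq] at hK
  set C := chain B
  set m : Fin (n + 1) → ℝ := fun k => numEdges (B k).graph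
  -- `U` and `A` are extended by zero to all pairs, so that the filtered sums become full double
  -- sums. Neither is symmetric; the symmetric block form is expressed through `U i j + U j i` and
  -- `A i j + A j i`.
  set U : Fin (n + 1) → Fin (n + 1) → ℝ := fun i j => if j ≠ i then
    m i * graphMoment (B j).graph (if i < j then (B j).left else (B j).right) else 0 with hU
  set A : Fin (n + 1) → Fin (n + 1) → ℝ := fun i j => if i.val + 2 ≤ j.val then
    m i * m j * resistance C.graph (C.emb i (B i).right) (C.emb j (B j).left) else 0 with hA
  have hlt : ∀ i j, i < j → C.blockResistance i j = 2 * (U i j + U j i) + 4 * (A i j + A j i) := by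
    intro i j hij
    have hij' : i.val < j.val := hij
    have hU1 : U i j = m i * graphMoment (B j).graph (B j).left := by
      simp only [hU, if_pos hij, if_pos hij.ne']
    have hU2 : U j i = m j * graphMoment (B i).graph (B i).right := by
      simp only [hU, if_neg hij.not_gt, if_pos hij.ne]
    have hA1 : A i j = m i * m j *
        resistance C.graph (C.emb i (B i).right) (C.emb j (B j).left) := by
      simp only [hA]
      split_ifs with h
      · rfl
      -- Here `j = i + 1`: the two attachment vertices are identified, so the formula omits this
      -- pair without loss.
      · rw [hC.glue i j (by omega), resistance_self, mul_zero]
    have hA2 : A j i = 0 := if_neg (by omega)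
    rw [hC.blockResistance_lt hij, hU1, hU2, hA1, hA2]
    ring
  have hS : ∀ i j, C.blockResistance i j =
      (if i = j then 4 * (m i * kemeny (B i).graph) else 0) +
        2 * (U i j + U j i) + 4 * (A i j + A j i) := by
    intro i j
    rcases lt_trichotomy i j with h | rfl | h
    · rw [if_neg h.ne, hlt i j h]; ring
    · have hU0 : U i i = 0 := by simp [hU]
      have hA0 : A i i = 0 := by simp [hA]
      rw [if_pos rfl, hU0, hA0, hC.blockResistance_self,
        ← four_mul_numEdges_mul_kemeny (hconn i)]
      ring
    · rw [if_neg h.ne', C.blockResistance_comm, hlt j i h]; ring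
  have hcomm : ∀ T : Fin (n + 1) → Fin (n + 1) → ℝ, ∑ i, ∑ j, (T i j + T j i) =
      2 * ∑ i, ∑ j, T i j := by
    intro T
    simp only [Finset.sum_add_distrib]
    rw [Finset.sum_comm (f := fun i j => T j i)]
    ring
  have hsum : ∑ i, ∑ j, C.blockResistance i j = 4 * ∑ i, m i * kemeny (B i).graph +
      4 * ∑ i, ∑ j, U i j + 8 * ∑ i, ∑ j, A i j := by
    have e : ∑ i, ∑ j, C.blockResistance i j = 4 * ∑ i, m i * kemeny (B i).graph +
        2 * ∑ i, ∑ j, (U i j + U j i) + 4 * ∑ i, ∑ j, (A i j + A j i) := by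
      simp only [hS, mul_add, Finset.mul_sum, Finset.sum_add_distrib, Finset.sum_ite_eq,
        Finset.mem_univ, if_true]
    rw [e, hcomm, hcomm]
    ring
  have hUs : ∑ i, m i * ((kemeny (B i).graph : ℝ) + ∑ j with j ≠ i,
      graphMoment (B j).graph (if i < j then (B j).left else (B j).right)) =
      ∑ i, m i * kemeny (B i).graph + ∑ i, ∑ j, U i j := by
    rw [← Finset.sum_add_distrib]
    refine Finset.sum_congr rfl fun i _ => ?_
    rw [mul_add, Finset.mul_sum, Finset.sum_filter]
  have hAs : ∑ i : Fin (n + 1), ∑ j with i.val + 2 ≤ j.val, m i * m j *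
      resistance C.graph (C.emb i (B i).right) (C.emb j (B j).left) = ∑ i, ∑ j, A i j :=
    Finset.sum_congr rfl fun i _ => by rw [Finset.sum_filter]
  rw [hUs, hAs]
  -- Both sides are now compared after multiplication by `4`: symmetrization has turned the
  -- coefficients `2` of `U` and `4` of `A` into `4` and `8`.
  linarith
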